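/- **Setting.** Fix an order $m\ge 1$, latent dimensions $\bm s=(s_1,\dots,s_m)$ with all $s_k\ge 1$, and $M\in\mathbb R$. For $\bm d=(d_1,\dots,d_m)$ write $\bar d=\max_k d_k$, $\underline d=\min_k d_k$, $d_*=\prod_k d_k$, $\bar s=\max_k s_k$. Let $\mathcal P(\bm d,\bm s,M)$ be the set of tensors $\Theta\in\mathbb R^{d_1\times\cdots\times d_m}$ of the form $\Theta(i_1,\dots,i_m)=f(\bm a^{(1)}_{i_1},\dots,\bm a^{(m)}_{i_m})$, where each $\bm a^{(k)}_{i}$ lies in the closed sup-norm unit ball $B_k$ of $\mathbb R^{s_k}$ and $f:\mathbb R^{s_1}\times\cdots\times\mathbb R^{s_m}\to\mathbb R$ is smooth at every point of $B_1\times\cdots\times B_m$ with $\sup_{B_1\times\cdots\times B_m}|\partial^{\bm\alpha}f|\le M^{|\bm\alpha|}\bm\alpha!$ for all multi-indices $\bm\alpha$ over the $s_1+\cdots+s_m$ real coordinates. The Tucker rank of a tensor is the vector of the ranks of its $m$ unfoldings, and inequalities between Tucker ranks are entrywise. Call $c>0$ an *approximation constant* for $(\bm s,M)$ if there is $A$ such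 that for all $\bm d$, all $\Theta\in\mathcal P(\bm d,\bm s,M)$ and all integers $r\ge1$ there is a tensor $\mathcal X$ of Tucker rank at most $(r,\dots,r)$ with $\|\Theta-\mathcal X\|_\infty\le A\,e^{-c\,r^{1/\bar s}}$. **Theorem (statistical upper bound).** An approximation constant exists. Let $c=c(\bm s,M)$ be any approximation constant, and let $r$ be the number $c^{-\bar s}\log^{\bar s}(d_*/\bar d)$ rounded (up or down) to an integer. Suppose $\mathcal Y=\Theta+\mathcal E$ with $\Theta\in\mathcal P(\bm d,\bm s,M)$ and with $\mathcal E$ having i.i.d. standard Gaussian entries, and let $\hat\Theta$ be any minimizer of $\|\mathcal Y-T\|_F$ over the tensors $T$ of Tucker rank at most $(r,\dots,r)$; such a minimizer always exists. Then, with constants depending only on $m,\bm s,M,c$: (i) there is $C>0$ such that, with probability tending to $1$ as $\underline d\to\infty$, uniformly over $\Theta\in\mathcal P(\bm d,\bm s,M)$, $$\|\hat\Theta-\Theta\|_F^2\le C\left(r^m+r\bar d+d_*\exp(-c\,r^{1/\bar s})\right);$$ (ii) the right-hand side is $\tilde O(\bar d)$: there are $C'>0$ and $p\in\mathbb N$ such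 that $r^m+r\bar d+d_*\exp(-c\,r^{1/\bar s})\le C'\,\bar d\,\log^p\bar d$ for all $\bm d$ with $\underline d$ large enough. -/

import Mathlib

noncomputable section

namespace LatentTensor

/-- Real order-`m` tensors of dimension `(d 0, …, d (m-1))`. -/
abbrev Tensor {m : ℕ} (d : Fin m → ℕ) : Type := ((k : Fin m) → Fin (d k)) → ℝ

/-- The Frobenius norm of a tensor. -/
def frobNorm {m : ℕ} {d : Fin m → ℕ} (T : Tensor d) : ℝ := Real.sqrt (∑ i, T i ^ 2)

/-- The mode-`k` unfolding: rows are indexed by the `k`-th index, columns by all the others. -/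
def unfold {m : ℕ} {d : Fin m → ℕ} (k : Fin m) (T : Tensor d) :
    Matrix (Fin (d k)) ((j : {j : Fin m // j ≠ k}) → Fin (d j)) ℝ :=
  Matrix.of fun a b => T ((Equiv.piSplitAt k fun j => Fin (d j)).symm (a, b))

/-- `Tucker-rank(T) ≤ (r, …, r)`. -/
def TuckerRankLE {m : ℕ} {d : Fin m → ℕ} (r : ℕ) (T : Tensor d) : Prop :=
  ∀ k : Fin m, (unfold k T).rank ≤ r

/-- The largest entry of a vector of dimensions (written `d̄`, `s̄`). -/
def dimMax {m : ℕ} (d : Fin m → ℕ) : ℕ := Finset.univ.sup d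

/-- The product of the entries of a vector of dimensions (written `d_*`). -/
def dimProd {m : ℕ} (d : Fin m → ℕ) : ℕ := ∏ k, d k

/-- The `j`-th standard basis vector in the `k`-th factor of `ℝ^{s_1} × ⋯ × ℝ^{s_m}`, where
`q = (k, j)`. -/
def coordVec {m : ℕ} {s : Fin m → ℕ} (q : (k : Fin m) × Fin (s k)) :
    (k : Fin m) → Fin (s k) → ℝ :=
  Pi.single q.1 (Pi.single q.2 1)

/-- `f` is `M`-analytic on the product of the closed sup-norm unit balls: `f` is smooth at each
point `x` of it, and `|∂^α f(x)| ≤ M^|α| α!` for each multi-index `α`.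
A multi-index is presented by a finite sequence `v` of coordinates; `α q` is the number of times
that the coordinate `q` occurs in `v`, so that `|α| = n`, and each `α` arises in this way. -/
def IsMAnalytic {m : ℕ} (s : Fin m → ℕ) (M : ℝ) (f : ((k : Fin m) → Fin (s k) → ℝ) → ℝ) : Prop :=
  ∀ x : (k : Fin m) → Fin (s k) → ℝ, (∀ k, x k ∈ Metric.closedBall (0 : Fin (s k) → ℝ) 1) →
    ContDiffAt ℝ (⊤ : ℕ∞) f x ∧
    ∀ (n : ℕ) (v : Fin n → (k : Fin m) × Fin (s k)),
      |iteratedFDeriv ℝ n f x (fun j => coordVec (v j))| ≤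
        M ^ n * ((∏ q : (k : Fin m) × Fin (s k),
          (Finset.univ.filter fun j : Fin n => v j = q).card.factorial : ℕ) : ℝ)

/-- The latent variable tensor model `P(d, s, M)`: the tensors
`Θ(i_1, …, i_m) = f(a^{(1)}_{i_1}, …, a^{(m)}_{i_m})` with latent vectors in the closed sup-norm
unit balls and an `M`-analytic latent function `f`. -/
def latentModel {m : ℕ} (d s : Fin m → ℕ) (M : ℝ) : Set (Tensor d) :=
  {Θ | ∃ (f : ((k : Fin m) → Fin (s k) → ℝ) → ℝ) (a : (k : Fin m) → Fin (d k) → Fin (s k) → ℝ),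
    IsMAnalytic s M f ∧
    (∀ k i, a k i ∈ Metric.closedBall (0 : Fin (s k) → ℝ) 1) ∧
    ∀ i, Θ i = f (fun k => a k (i k))}

/-- `c > 0` is a constant for the dimension-free approximation of `P(d, s, M)` by tensors of low
Tucker rank: uniformly over all dimensions `d`, signals `Θ ∈ P(d, s, M)` and ranks `r ≥ 1`, some
`X` with Tucker rank at most `(r, …, r)` has entrywise error `O(exp(-c r^{1/s̄}))`. -/
def IsApproxConst {m : ℕ} (s : Fin m → ℕ) (M c : ℝ) : Prop :=
  0 < c ∧ ∃ A : ℝ, ∀ (d : Fin m → ℕ), ∀ Θ ∈ latentModel d s M, ∀ r : ℕ, 1 ≤ r →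
    ∃ X : Tensor d, TuckerRankLE r X ∧
      ∀ i, |Θ i - X i| ≤ A * Real.exp (-c * (r : ℝ) ^ (1 / (dimMax s : ℝ)))

/-- `r` is the number `c^{-s̄} log^{s̄}(d_* / d̄)` rounded to an integer (down or up). -/
def IsFittedRank {m : ℕ} (d s : Fin m → ℕ) (c : ℝ) (r : ℕ) : Prop :=
  |(r : ℝ) - c⁻¹ ^ dimMax s * Real.log ((dimProd d : ℝ) / (dimMax d : ℝ)) ^ dimMax s| < 1

/-- `T` is a least-squares fit to `Y` among the tensors of Tucker rank at most `(r, …, r)`. -/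
def IsLSE {m : ℕ} {d : Fin m → ℕ} (r : ℕ) (Y T : Tensor d) : Prop :=
  TuckerRankLE r T ∧ ∀ T' : Tensor d, TuckerRankLE r T' → frobNorm (Y - T) ≤ frobNorm (Y - T')

/-- The entries of the random tensor `E` are i.i.d. standard Gaussian. -/
def IsGaussianNoise {m : ℕ} {d : Fin m → ℕ} {Ω : Type*} [MeasurableSpace Ω]
    (μ : MeasureTheory.Measure Ω) (E : Ω → Tensor d) : Prop :=
  ProbabilityTheory.iIndepFun (fun i ω => E ω i) μ ∧
  ∀ i, ProbabilityTheory.HasLaw (fun ω => E ω i) (ProbabilityTheory.gaussianReal 0 1) μ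

/-- Estimation error plus approximation error: `r^m + r d̄ + d_* exp(-c r^{1/s̄})`. -/
def lseRate {m : ℕ} (d s : Fin m → ℕ) (c : ℝ) (r : ℕ) : ℝ :=
  (r : ℝ) ^ m + (r : ℝ) * (dimMax d : ℝ) +
    (dimProd d : ℝ) * Real.exp (-c * (r : ℝ) ^ (1 / (dimMax s : ℝ)))

end LatentTensor

end

/-! ### Low Tucker rank approximation by piecewise Taylor polynomials -/

namespace LatentTensor

/-! Approximation. Cover each ball by a finite `δ`-net whose size does not depend on `d`, and
replace `f` by its Taylor polynomial of order `< l` at the net points nearest to the latent vectors.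
In the mode-`k` unfolding the row index enters only through its cell and the monomials in the `s k`
coordinates, so the rank is at most (number of cells) `* l ^ s k` (`rank_unfold_taylorSum_le`). For
small `δ` analyticity makes the error exponential in `l`, and `l` can be taken of order `r ^ (1 /
s̄)` (`exists_isApproxConst`).

Estimation. Comparing the least-squares fit with a low-rank approximant `X` of `Θ` bounds the error
by `‖Θ - X‖` and the supremum of the noise over unit tensors of Tucker rank at most `2 * r`
(`lse_error_le`). That supremum is controlled by finitely many test tensors: a Tucker tensor is
multilinear in its core and factors, so norming sets of the unit balls of these spaces combine into
one for the whole class, with log-cardinality of order `r ^ m + r * d̄` (`hasNorming_tuckerRankLE`).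
A sub-Gaussian union bound finishes (`measure_sup_inner_le`).

This works for every `r`; the fitted rank matters only for the `Õ(d̄)` rate (`lseRate_le_polylog`).
-/

/-- Grouping the terms `τ` by `β τ` factors `X` through `K × J`; the left factor puts row `a` in the
block `κ a`. The size of `T` does not matter. -/
theorem rank_le_of_sum_factor {A B T K J : Type*} [Fintype A] [Fintype B] [Fintype T] [Fintype K]
    [Fintype J] (X : Matrix A B ℝ) (κ : A → K) (β : T → J) (g : A → J → ℝ) (G : T → K → B → ℝ)
    (h : ∀ a b, X a b = ∑ τ, g a (β τ) * G τ (κ a) b) :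
    X.rank ≤ Fintype.card K * Fintype.card J := by
  classical
  let U : Matrix A (K × J) ℝ := Matrix.of fun a p => if κ a = p.1 then g a p.2 else 0
  let V : Matrix (K × J) B ℝ := Matrix.of fun p b => ∑ τ, if β τ = p.2 then G τ p.1 b else 0
  have hX : X = U * V := by
    ext a b
    rw [h, Matrix.mul_apply, Fintype.sum_prod_type]
    simp only [U, V, Matrix.of_apply, ite_mul, zero_mul, Finset.mul_sum, mul_ite, mul_zero]
    rw [Finset.sum_eq_single (κ a)]
    · simp only [if_true]
      rw [Finset.sum_comm]
      simp
    · intro c _ hc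
      simp [hc.symm]
    · simp
  rw [hX, ← Fintype.card_prod]
  exact (Matrix.rank_mul_le_left U V).trans (Matrix.rank_le_card_width U)

theorem prod_factorial_count_le {Q : Type*} [Fintype Q] [DecidableEq Q] {n : ℕ} (v : Fin n → Q) :
    ∏ q, (Finset.univ.filter fun j => v j = q).card.factorial ≤ n.factorial := by
  have h := Nat.prod_factorial_dvd_factorial_sum Finset.univ
    (fun q => (Finset.univ.filter fun j => v j = q).card)
  have h2 : ∑ q, (Finset.univ.filter fun j => v j = q).card = n := by
    rw [← Finset.card_eq_sum_card_fiberwise (f := v) (fun _ _ => Finset.mem_coe.2 (Finset.mem_univ _))]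
    simp
  rw [h2] at h
  exact Nat.le_of_dvd n.factorial_pos h

theorem prod_comp_eq_prod_pow_count {Q : Type*} [Fintype Q] [DecidableEq Q] {n : ℕ} (v : Fin n → Q)
    (y : Q → ℝ) : ∏ j, y (v j) = ∏ q, y q ^ (Finset.univ.filter fun j => v j = q).card := by
  rw [← Finset.prod_fiberwise_of_maps_to (g := v) (t := Finset.univ) (by simp)]
  refine Finset.prod_congr rfl fun q _ => ?_
  rw [← Finset.prod_const]
  refine Finset.prod_congr rfl fun j hj => ?_
  rw [(Finset.mem_filter.1 hj).2]

variable {m : ℕ} {s : Fin m → ℕ}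

theorem sum_smul_coordVec (y : (k : Fin m) → Fin (s k) → ℝ) :
    ∑ q : (k : Fin m) × Fin (s k), y q.1 q.2 • coordVec q = y := by
  rw [Fintype.sum_sigma]
  funext k j
  simp only [coordVec, Finset.sum_apply, Pi.smul_apply, smul_eq_mul]
  rw [Finset.sum_eq_single k]
  · rw [Finset.sum_eq_single j]
    · simp
    · intro b _ hb
      simp [hb.symm]
    · simp
  · intro b _ hb
    simp [Pi.single_eq_of_ne hb.symm]
  · simp

theorem multilinear_apply_diag {n : ℕ}
    (L : ContinuousMultilinearMap ℝ (fun _ : Fin n => (k : Fin m) → Fin (s k) → ℝ) ℝ)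
    (y : (k : Fin m) → Fin (s k) → ℝ) :
    L (fun _ => y) = ∑ v : Fin n → (k : Fin m) × Fin (s k),
      (∏ j, y (v j).1 (v j).2) * L (fun j => coordVec (v j)) := by
  conv_lhs => rw [← sum_smul_coordVec y]
  rw [L.map_sum]
  refine Finset.sum_congr rfl fun v _ => ?_
  rw [L.map_smul_univ]
  rfl

/-- Expand into sequences of coordinates and use `α! ≤ n!`. This crude `n!` is cancelled by the
Taylor coefficient. -/
theorem IsMAnalytic.abs_diag_le {M : ℝ} {f : ((k : Fin m) → Fin (s k) → ℝ) → ℝ}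
    (hf : IsMAnalytic s M f) {x : (k : Fin m) → Fin (s k) → ℝ}
    (hx : ∀ k, x k ∈ Metric.closedBall (0 : Fin (s k) → ℝ) 1)
    {y : (k : Fin m) → Fin (s k) → ℝ} {δ : ℝ} (hy : ∀ k j, |y k j| ≤ δ) (n : ℕ) :
    |iteratedFDeriv ℝ n f x (fun _ => y)| ≤
      (δ * |M| * Fintype.card ((k : Fin m) × Fin (s k))) ^ n * n.factorial := by
  rw [multilinear_apply_diag]
  refine (Finset.abs_sum_le_sum_abs _ _).trans ?_
  have hb : ∀ v : Fin n → (k : Fin m) × Fin (s k),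
      |(∏ j, y (v j).1 (v j).2) * iteratedFDeriv ℝ n f x (fun j => coordVec (v j))| ≤
        δ ^ n * (|M| ^ n * n.factorial) := by
    intro v
    rw [abs_mul, Finset.abs_prod]
    have h1 : ∏ j, |y (v j).1 (v j).2| ≤ δ ^ n := by
      calc ∏ j, |y (v j).1 (v j).2| ≤ ∏ _j : Fin n, δ :=
            Finset.prod_le_prod (fun _ _ => abs_nonneg _) (fun j _ => hy _ _)
        _ = δ ^ n := by simp
    have h2 := (hf x hx).2 n v
    refine mul_le_mul h1 (h2.trans ?_) (abs_nonneg _)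
      ((Finset.prod_nonneg fun _ _ => abs_nonneg _).trans h1)
    refine mul_le_mul ?_ ?_ (by positivity) (by positivity)
    · rw [← abs_pow]
      exact le_abs_self _
    · exact_mod_cast prod_factorial_count_le v
  refine (Finset.sum_le_sum fun v _ => hb v).trans (le_of_eq ?_)
  rw [Finset.sum_const, Finset.card_univ, Fintype.card_fun, Fintype.card_fin, nsmul_eq_mul]
  push_cast
  ring

theorem IsMAnalytic.abs_le_one {M : ℝ} {f : ((k : Fin m) → Fin (s k) → ℝ) → ℝ}
    (hf : IsMAnalytic s M f) {x : (k : Fin m) → Fin (s k) → ℝ}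
    (hx : ∀ k, x k ∈ Metric.closedBall (0 : Fin (s k) → ℝ) 1) : |f x| ≤ 1 := by
  simpa using (hf x hx).2 0 Fin.elim0

/-- The Taylor polynomial of order `< l` of `f` at `x`, evaluated at `x + y`. -/
noncomputable def taylorSum (f : ((k : Fin m) → Fin (s k) → ℝ) → ℝ) (l : ℕ)
    (x y : (k : Fin m) → Fin (s k) → ℝ) : ℝ :=
  ∑ n ∈ Finset.range l, (n.factorial : ℝ)⁻¹ • iteratedFDeriv ℝ n f x (fun _ => y)

/-- Integral remainder along the segment, which stays in the balls by convexity. The factor `n + 1`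
is `(n + 1)! / n!`, as `(1 - t) ^ n` is bounded by `1`. -/
theorem IsMAnalytic.abs_sub_taylorSum_le {M : ℝ} {f : ((k : Fin m) → Fin (s k) → ℝ) → ℝ}
    (hf : IsMAnalytic s M f) {x y : (k : Fin m) → Fin (s k) → ℝ}
    (hx : ∀ k, x k ∈ Metric.closedBall (0 : Fin (s k) → ℝ) 1)
    (hxy : ∀ k, (x + y) k ∈ Metric.closedBall (0 : Fin (s k) → ℝ) 1)
    {δ : ℝ} (hy : ∀ k j, |y k j| ≤ δ) (n : ℕ) :
    |f (x + y) - taylorSum f (n + 1) x y| ≤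
      (n + 1) * (δ * |M| * Fintype.card ((k : Fin m) × Fin (s k))) ^ (n + 1) := by
  have hseg : ∀ t ∈ Set.Icc (0 : ℝ) 1, ∀ k,
      (x + t • y) k ∈ Metric.closedBall (0 : Fin (s k) → ℝ) 1 := by
    intro t ht k
    have := (convex_closedBall (0 : Fin (s k) → ℝ) 1).add_smul_mem (hx k) (hxy k) ht
    exact this
  rw [taylorSum, map_add_eq_sum_add_integral_iteratedFDeriv (n := n) (f := f) (x := x) (y := y)
    (fun t ht => ((hf _ (hseg t ht)).1).of_le (by exact_mod_cast le_top)), add_sub_cancel_left,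
    smul_eq_mul, abs_mul, abs_inv, Nat.abs_cast]
  have hI := intervalIntegral.norm_integral_le_of_norm_le_const (a := (0 : ℝ)) (b := 1)
    (f := fun t : ℝ => (1 - t) ^ n • iteratedFDeriv ℝ (n + 1) f (x + t • y) (fun _ => y))
    (C := (δ * |M| * Fintype.card ((k : Fin m) × Fin (s k))) ^ (n + 1) * (n + 1).factorial) (by
      intro t ht
      rw [Set.uIoc_of_le zero_le_one] at ht
      have h1 := hf.abs_diag_le (hseg t ⟨ht.1.le, ht.2⟩) hy (n + 1)
      rw [norm_smul, Real.norm_eq_abs, Real.norm_eq_abs, abs_pow]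
      have h2 : |1 - t| ^ n ≤ 1 :=
        pow_le_one₀ (abs_nonneg _) (by rw [abs_le]; constructor <;> linarith [ht.1, ht.2])
      calc _ ≤ 1 * _ := mul_le_mul h2 h1 (abs_nonneg _) zero_le_one
        _ = _ := one_mul _)
  rw [Real.norm_eq_abs] at hI
  have hn : (0 : ℝ) < n.factorial := by positivity
  rw [inv_mul_le_iff₀ hn]
  refine hI.trans (le_of_eq ?_)
  rw [Nat.factorial_succ]
  push_cast
  simp
  ring

/-- Each term is a product over modes of monomials in `y`, times a coefficient depending on `x`
only; this separation of modes gives the rank bound. -/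
theorem taylorSum_eq_sum_sigma (f : ((k : Fin m) → Fin (s k) → ℝ) → ℝ) (l : ℕ)
    (x y : (k : Fin m) → Fin (s k) → ℝ) :
    taylorSum f l x y = ∑ τ : (n : Fin l) × (Fin n → (k : Fin m) × Fin (s k)),
      (∏ k, ∏ t, y k t ^ (Finset.univ.filter fun j => τ.2 j = ⟨k, t⟩).card) *
        ((τ.1.1.factorial : ℝ)⁻¹ * iteratedFDeriv ℝ τ.1.1 f x (fun j => coordVec (τ.2 j))) := by
  rw [taylorSum, Fintype.sum_sigma, Finset.sum_range]
  refine Finset.sum_congr rfl fun n _ => ?_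
  rw [multilinear_apply_diag, smul_eq_mul, Finset.mul_sum]
  refine Finset.sum_congr rfl fun v _ => ?_
  rw [prod_comp_eq_prod_pow_count v (fun q => y q.1 q.2), Fintype.prod_sigma]
  ring

theorem rank_unfold_taylorSum_le {d : Fin m → ℕ} (f : ((k : Fin m) → Fin (s k) → ℝ) → ℝ) (l : ℕ)
    {N : Fin m → Type*} [∀ k, Fintype (N k)] (pt : ∀ k, N k → Fin (s k) → ℝ)
    (κ : ∀ k, Fin (d k) → N k) (a : ∀ k, Fin (d k) → Fin (s k) → ℝ) (k : Fin m) :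
    (unfold (d := d) k fun i => taylorSum f l (fun k => pt k (κ k (i k)))
      (fun k => a k (i k) - pt k (κ k (i k)))).rank ≤ Fintype.card (N k) * l ^ s k := by
  have hcard : l ^ s k = Fintype.card (Fin (s k) → Fin l) := by simp
  rw [hcard]
  let y : ∀ k, Fin (d k) → Fin (s k) → ℝ := fun k i => a k i - pt k (κ k i)
  refine rank_le_of_sum_factor _ (κ k)
    (T := (n : Fin l) × (Fin n → (k : Fin m) × Fin (s k)))
    -- The mode-`k` exponents of `τ`, each below `l` since the sequence `τ.2` has length below `l`.
    (fun τ t => ⟨(Finset.univ.filter fun j => τ.2 j = ⟨k, t⟩).card,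
      ((Finset.card_le_univ _).trans (by simp)).trans_lt τ.1.2⟩)
    (fun i β => ∏ t, y k i t ^ (β t : ℕ))
    (fun τ c b => (∏ k' : {k' // k' ≠ k}, ∏ t,
      y k' (b k') t ^ (Finset.univ.filter fun j => τ.2 j = ⟨k', t⟩).card) *
        ((τ.1.1.factorial : ℝ)⁻¹ * iteratedFDeriv ℝ τ.1.1 f
          ((Equiv.piSplitAt k fun k => Fin (s k) → ℝ).symm (pt k c, fun j => pt j (κ j (b j))))
          (fun j => coordVec (τ.2 j)))) ?_
  intro i b
  rw [unfold, Matrix.of_apply, taylorSum_eq_sum_sigma]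
  refine Finset.sum_congr rfl fun τ _ => ?_
  rw [Fintype.prod_eq_mul_prod_subtype_ne _ k, mul_assoc]
  have hx : (fun k' => pt k' (κ k' ((Equiv.piSplitAt k fun j => Fin (d j)).symm (i, b) k'))) =
      (Equiv.piSplitAt k fun k => Fin (s k) → ℝ).symm
        (pt k (κ k i), fun j => pt j (κ j (b j))) := by
    funext k'
    by_cases h : k' = k
    · subst h
      simp
    · simp [h]
  have hk : (Equiv.piSplitAt k fun j => Fin (d j)).symm (i, b) k = i := by simp
  have hne : ∀ k' : {k' // k' ≠ k},
      (Equiv.piSplitAt k fun j => Fin (d j)).symm (i, b) k' = b k' := by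
    intro k'
    simp [k'.2]
  rw [hx, hk]
  simp only [hne]
  rfl

theorem latentModel.abs_le_one {d : Fin m → ℕ} {M : ℝ} {Θ : Tensor d}
    (hΘ : Θ ∈ latentModel d s M) (i) : |Θ i| ≤ 1 := by
  obtain ⟨f, a, hf, ha, h⟩ := hΘ
  rw [h]
  exact hf.abs_le_one fun k => ha k _

theorem exists_finset_net_closedBall {E : Type*} [NormedAddCommGroup E] [ProperSpace E] {δ : ℝ}
    (hδ : 0 < δ) : ∃ N : Finset E, (∀ c ∈ N, c ∈ Metric.closedBall (0 : E) 1) ∧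
      ∀ x ∈ Metric.closedBall (0 : E) 1, ∃ c ∈ N, ‖x - c‖ ≤ δ := by
  obtain ⟨t, ht, hfin, hcov⟩ := (isCompact_closedBall (0 : E) 1).finite_cover_balls hδ
  refine ⟨hfin.toFinset, fun c hc => ht (hfin.mem_toFinset.1 hc), fun x hx => ?_⟩
  obtain ⟨c, hc, hxc⟩ := Set.mem_iUnion₂.1 (hcov hx)
  exact ⟨c, hfin.mem_toFinset.2 hc, by rw [← dist_eq_norm]; exact (Metric.mem_ball.1 hxc).le⟩

theorem tuckerRankLE_zero {d : Fin m → ℕ} (r : ℕ) : TuckerRankLE r (0 : Tensor d) := by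
  intro k
  have : unfold k (0 : Tensor d) = 0 := rfl
  rw [this, Matrix.rank_zero]
  exact Nat.zero_le _

theorem le_dimMax (d : Fin m → ℕ) (k : Fin m) : d k ≤ dimMax d := Finset.le_sup (Finset.mem_univ k)

theorem exists_isApproxConst (hm : 1 ≤ m) (hs : ∀ k, 1 ≤ s k) (M : ℝ) :
    ∃ c : ℝ, IsApproxConst s M c := by
  obtain ⟨δ, hδ, hρ⟩ : ∃ δ : ℝ, 0 < δ ∧
      δ * |M| * Fintype.card ((k : Fin m) × Fin (s k)) ≤ Real.exp (-2) := by
    generalize Fintype.card ((k : Fin m) × Fin (s k)) = S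
    -- The `+ 1` keeps the denominator positive when `M = 0`.
    refine ⟨Real.exp (-2) / (|M| * S + 1), by positivity, ?_⟩
    rw [div_mul_eq_mul_div, div_mul_eq_mul_div, div_le_iff₀ (by positivity)]
    nlinarith [Real.exp_pos (-2)]
  have hρ0 : 0 ≤ δ * |M| * Fintype.card ((k : Fin m) × Fin (s k)) := by positivity
  choose N hN hcov using fun k => exists_finset_net_closedBall (E := Fin (s k) → ℝ) hδ
  obtain ⟨n0, hn0, hn0k⟩ : ∃ n0 : ℕ, 0 < n0 ∧ ∀ k, (N k).card ≤ n0 :=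
    ⟨1 + ∑ k, (N k).card, by omega, fun k =>
      (Finset.single_le_sum (f := fun k => (N k).card) (fun _ _ => Nat.zero_le _)
        (Finset.mem_univ k)).trans (Nat.le_add_left _ _)⟩
  have hn0pos : (0 : ℝ) < n0 := by exact_mod_cast hn0
  have hsb : 1 ≤ dimMax s := (hs ⟨0, hm⟩).trans (le_dimMax s _)
  have hsb0 : dimMax s ≠ 0 := by omega
  -- With this `c`, `z = c * r ^ (1 / s̄)` satisfies `n0 * z ^ s̄ = r`, so order `⌊z⌋₊` respects the
  -- rank budget; the constant `e` pays for the floor.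
  refine ⟨((n0 : ℝ)⁻¹) ^ (1 / (dimMax s : ℝ)), by positivity, Real.exp 1, ?_⟩
  intro d Θ hΘ r hr
  set z : ℝ := ((r : ℝ) / n0) ^ (1 / (dimMax s : ℝ)) with hz
  have hz0 : 0 ≤ z := by positivity
  have hzc : -((n0 : ℝ)⁻¹) ^ (1 / (dimMax s : ℝ)) * (r : ℝ) ^ (1 / (dimMax s : ℝ)) = -z := by
    rw [hz, div_eq_inv_mul (r : ℝ), Real.mul_rpow (by positivity) (by positivity)]
    ring
  rw [hzc, ← Real.exp_add]
  have hfl : z < ⌊z⌋₊ + 1 := Nat.lt_floor_add_one z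
  rcases Nat.eq_zero_or_pos ⌊z⌋₊ with h0 | hpos
  · refine ⟨0, tuckerRankLE_zero r, fun i => ?_⟩
    have h1 := latentModel.abs_le_one hΘ i
    rw [h0] at hfl
    have : 1 ≤ Real.exp (1 + -z) := Real.one_le_exp (by push_cast at hfl; linarith)
    simpa using h1.trans this
  · obtain ⟨f, a, hf, ha, hΘ⟩ := hΘ
    choose c hcN hc using fun k i => hcov k (a k i) (ha k i)
    let κ : ∀ k, Fin (d k) → N k := fun k i => ⟨c k i, hcN k i⟩
    obtain ⟨n, hn⟩ : ∃ n, ⌊z⌋₊ = n + 1 := ⟨⌊z⌋₊ - 1, by omega⟩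
    refine ⟨fun i => taylorSum f (n + 1) (fun k => c k (i k)) (fun k => a k (i k) - c k (i k)),
      fun k => ?_, fun i => ?_⟩
    · refine (rank_unfold_taylorSum_le f (n + 1) (N := fun k => N k) (fun k p => p.1) κ a k).trans ?_
      rw [Fintype.card_coe]
      have h1 : ((n + 1 : ℕ) : ℝ) ≤ z := hn ▸ Nat.floor_le hz0
      have h2 : ((n + 1 : ℕ) : ℝ) ^ dimMax s ≤ r / n0 := by
        calc ((n + 1 : ℕ) : ℝ) ^ dimMax s ≤ z ^ dimMax s := by gcongr
          _ = r / n0 := by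
            rw [hz, ← Real.rpow_natCast, ← Real.rpow_mul (by positivity), one_div,
              inv_mul_cancel₀ (by exact_mod_cast hsb0), Real.rpow_one]
      have h3 : (n0 : ℝ) * ((n + 1 : ℕ) : ℝ) ^ dimMax s ≤ r := by
        rwa [le_div_iff₀ hn0pos, mul_comm] at h2
      have h4 : n0 * (n + 1) ^ dimMax s ≤ r := by exact_mod_cast h3
      refine le_trans ?_ h4
      exact Nat.mul_le_mul (hn0k k) (Nat.pow_le_pow_right (by omega) (le_dimMax s k))
    · have hxy : (fun k => c k (i k)) + (fun k => a k (i k) - c k (i k)) = fun k => a k (i k) := by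
        funext k
        simp
      have := hf.abs_sub_taylorSum_le (x := fun k => c k (i k))
        (y := fun k => a k (i k) - c k (i k)) (δ := δ) (fun k => hN k _ (hcN k _))
        (by rw [hxy]; exact fun k => ha k _)
        (fun k j => (norm_le_pi_norm (a k (i k) - c k (i k)) j).trans (hc k _)) n
      rw [hxy, ← hΘ] at this
      refine this.trans ?_
      -- Of the two exponentials in `exp (-2) ^ (n + 1)`, one absorbs the factor `n + 1`.
      calc ((n : ℝ) + 1) * (δ * |M| * Fintype.card ((k : Fin m) × Fin (s k))) ^ (n + 1)
          ≤ Real.exp ((n : ℝ) + 1) * Real.exp (-2) ^ (n + 1) := by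
            refine mul_le_mul ?_ (pow_le_pow_left₀ hρ0 hρ _) (by positivity) (by positivity)
            linarith [Real.add_one_le_exp ((n : ℝ) + 1)]
        _ = Real.exp (-((n : ℝ) + 1)) := by
            rw [← Real.exp_nat_mul, ← Real.exp_add]
            push_cast
            ring_nf
        _ ≤ Real.exp (1 + -z) := by
            rw [hn] at hfl
            push_cast at hfl
            exact Real.exp_le_exp.2 (by linarith)

end LatentTensor

/-! ### Rank inequalities, existence of the least-squares fit, orthonormal factors -/

namespace LatentTensor

theorem frobNorm_eq_norm {m : ℕ} {d : Fin m → ℕ} (T : Tensor d) :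
    frobNorm T = ‖(WithLp.toLp 2 T : EuclideanSpace ℝ ((k : Fin m) → Fin (d k)))‖ := by
  simp [frobNorm, EuclideanSpace.norm_eq]

theorem unfold_add {m : ℕ} {d : Fin m → ℕ} (k : Fin m) (S T : Tensor d) :
    unfold k (S + T) = unfold k S + unfold k T := rfl

theorem unfold_injective {m : ℕ} {d : Fin m → ℕ} (k : Fin m) :
    Function.Injective (unfold (d := d) k) := by
  intro S T h
  funext i
  have := congrFun₂ h (Equiv.piSplitAt k (fun j => Fin (d j)) i).1
    (Equiv.piSplitAt k (fun j => Fin (d j)) i).2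
  simpa only [unfold, Matrix.of_apply, Prod.mk.eta, Equiv.symm_apply_apply] using this

theorem rank_matrix_add_le {A B : Type*} [Fintype A] [Fintype B] (X Y : Matrix A B ℝ) :
    (X + Y).rank ≤ X.rank + Y.rank := by
  unfold Matrix.rank
  rw [Matrix.mulVecLin_add]
  exact (Submodule.finrank_mono (LinearMap.range_add_le _ _)).trans
    (Submodule.finrank_add_le_finrank_add_finrank _ _)

theorem rank_matrix_smul_le {A B : Type*} [Fintype A] [Fintype B] (c : ℝ) (X : Matrix A B ℝ) :
    (c • X).rank ≤ X.rank := by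
  classical
  rw [Matrix.smul_eq_mul_diagonal]
  exact Matrix.rank_mul_le_left _ _

theorem TuckerRankLE.smul {m : ℕ} {d : Fin m → ℕ} {r : ℕ} {T : Tensor d}
    (hT : TuckerRankLE r T) (c : ℝ) : TuckerRankLE r (c • T) := fun k =>
  (rank_matrix_smul_le c (unfold k T)).trans (hT k)

theorem TuckerRankLE.sub {m : ℕ} {d : Fin m → ℕ} {r r' : ℕ} {S T : Tensor d}
    (hS : TuckerRankLE r S) (hT : TuckerRankLE r' T) : TuckerRankLE (r + r') (S - T) := by
  intro k
  have h : S - T = S + (-1 : ℝ) • T := by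
    rw [neg_one_smul, sub_eq_add_neg]
  rw [h, unfold_add]
  exact (rank_matrix_add_le _ _).trans (add_le_add (hS k) (hT.smul (-1) k))

/-- Lower semicontinuity of the rank: `r + 1 ≤ rank` is an open condition on operators. -/
theorem isClosed_setOf_rank_le {A B : Type*} [Fintype A] [Fintype B] [DecidableEq B] (r : ℕ) :
    IsClosed {X : Matrix A B ℝ | X.rank ≤ r} := by
  let φ : Matrix A B ℝ →ₗ[ℝ] ((B → ℝ) →L[ℝ] (A → ℝ)) :=
    LinearMap.toContinuousLinearMap.toLinearMap ∘ₗ (Matrix.toLin'.toLinearMap)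
  have hφ : Continuous φ := φ.continuous_of_finiteDimensional
  have ho := (isOpen_setOfPred_nat_le_rank (𝕜 := ℝ) (E := B → ℝ)
    (F := A → ℝ) (r + 1)).preimage hφ
  rw [← isOpen_compl_iff]
  convert ho using 1
  ext X
  simp only [Set.mem_compl_iff, Set.mem_ofPred_eq, not_le, Set.mem_preimage]
  have h : ((φ X : (B → ℝ) →L[ℝ] (A → ℝ)) : (B → ℝ) →ₗ[ℝ] (A → ℝ)).rank = (X.rank : Cardinal) := by
    rw [Matrix.rank, Module.finrank_eq_rank]
    rfl
  rw [h]
  norm_cast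

theorem isClosed_setOf_tuckerRankLE {m : ℕ} (d : Fin m → ℕ) (r : ℕ) :
    IsClosed {T : Tensor d | TuckerRankLE r T} := by
  have h : {T : Tensor d | TuckerRankLE r T} =
      ⋂ k, unfold (d := d) k ⁻¹' {X | X.rank ≤ r} := by
    ext T
    simp [TuckerRankLE]
  rw [h]
  refine isClosed_iInter fun k => (isClosed_setOf_rank_le r).preimage ?_
  exact continuous_matrix fun a b => continuous_apply _

theorem exists_isLSE {m : ℕ} (d : Fin m → ℕ) (r : ℕ) (Y : Tensor d) : ∃ T : Tensor d, IsLSE r Y T := by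
  let e : EuclideanSpace ℝ ((k : Fin m) → Fin (d k)) → Tensor d := WithLp.ofLp
  have hc : IsClosed (e ⁻¹' {T : Tensor d | TuckerRankLE r T}) :=
    (isClosed_setOf_tuckerRankLE d r).preimage (PiLp.continuous_ofLp 2 _)
  obtain ⟨T, hT, h⟩ := hc.exists_infDist_eq_dist ⟨0, tuckerRankLE_zero r⟩ (WithLp.toLp 2 Y)
  refine ⟨e T, hT, fun T' hT' => ?_⟩
  have h1 := Metric.infDist_le_dist_of_mem (x := (WithLp.toLp 2 Y))
    (s := e ⁻¹' {T : Tensor d | TuckerRankLE r T}) (y := WithLp.toLp 2 T') hT'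
  rw [h, dist_eq_norm, dist_eq_norm] at h1
  rw [frobNorm_eq_norm, frobNorm_eq_norm]
  exact h1

open scoped Matrix.Norms.L2Operator

theorem l2_opNorm_le_one_of_transpose_mul_self {A B : Type*} [Fintype A] [Fintype B]
    [DecidableEq A] [DecidableEq B] {X : Matrix A B ℝ} (h : X.transpose * X = 1) : ‖X‖ ≤ 1 := by
  have h1 := Matrix.l2_opNorm_conjTranspose_mul_self X
  rw [Matrix.conjTranspose_eq_transpose_of_trivial, h] at h1
  have h2 : ‖(1 : Matrix B B ℝ)‖ ≤ 1 := by
    rw [← Matrix.diagonal_one, Matrix.l2_opNorm_diagonal]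
    exact (pi_norm_le_iff_of_nonneg zero_le_one).2 fun _ => by simp
  nlinarith [norm_nonneg X]

theorem l2_opNorm_transpose {A B : Type*} [Fintype A] [Fintype B]
    [DecidableEq A] [DecidableEq B] (X : Matrix A B ℝ) : ‖X.transpose‖ = ‖X‖ := by
  rw [← Matrix.conjTranspose_eq_transpose_of_trivial, Matrix.l2_opNorm_conjTranspose]

/-- The columns of `A` are an orthonormal basis of the column space of `X`, padded with zeros.
Keeping `A` square lets mode products stay in one tensor space. -/
theorem exists_partialIsometry_of_rank_le {p R : ℕ} {B : Type*} [Fintype B] {X : Matrix (Fin p) B ℝ}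
    (hX : X.rank ≤ R) : ∃ A : Matrix (Fin p) (Fin p) ℝ, ‖A‖ ≤ 1 ∧
      (∀ i (j : Fin p), R ≤ (j : ℕ) → A i j = 0) ∧ A * A.transpose * X = X := by
  classical
  let H : Submodule ℝ (EuclideanSpace ℝ (Fin p)) :=
    Submodule.span ℝ (Set.range fun b => WithLp.toLp 2 (X.col b))
  have hH : Module.finrank ℝ H = X.rank := by
    rw [Matrix.rank_eq_finrank_span_cols]
    have : H = (Submodule.span ℝ (Set.range X.col)).map
        (WithLp.linearEquiv 2 ℝ (Fin p → ℝ)).symm.toLinearMap := by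
      rw [Submodule.map_span, ← Set.range_comp]
      rfl
    rw [this]
    exact LinearEquiv.finrank_map_eq (WithLp.linearEquiv 2 ℝ (Fin p → ℝ)).symm _
  have hp : Module.finrank ℝ H ≤ p := by
    simpa using Submodule.finrank_le H
  let b := stdOrthonormalBasis ℝ H
  let U : Matrix (Fin p) (Fin (Module.finrank ℝ H)) ℝ := Matrix.of fun i j => (b j : EuclideanSpace ℝ (Fin p)) i
  let J : Matrix (Fin (Module.finrank ℝ H)) (Fin p) ℝ :=
    Matrix.of fun j j' => if (j : ℕ) = j' then 1 else 0
  have hU : U.transpose * U = 1 := by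
    ext j j'
    have := orthonormal_iff_ite.1 b.orthonormal j j'
    rw [Submodule.coe_inner, PiLp.inner_apply] at this
    simp only [Matrix.mul_apply, Matrix.transpose_apply, U, Matrix.of_apply, Matrix.one_apply]
    rw [← this]
    refine Finset.sum_congr rfl fun i _ => ?_
    simp [mul_comm]
  have hJ : J * J.transpose = 1 := by
    ext j j'
    simp only [Matrix.mul_apply, Matrix.transpose_apply, J, Matrix.of_apply, Matrix.one_apply]
    rw [Finset.sum_eq_single (Fin.castLE hp j)]
    · simp [Fin.ext_iff, eq_comm]
    · intro c _ hc
      have : (j : ℕ) ≠ c := fun h => hc (Fin.ext h.symm)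
      simp [this]
    · simp
  have hUX : U * U.transpose * X = X := by
    ext i c
    have hmem : WithLp.toLp 2 (X.col c) ∈ H := Submodule.subset_span ⟨c, rfl⟩
    have h := b.sum_repr' ⟨_, hmem⟩
    have h' := congrArg (fun x : H => (x : EuclideanSpace ℝ (Fin p)) i) h
    simp only [Submodule.coe_sum, Submodule.coe_smul, Submodule.coe_inner] at h'
    rw [Matrix.mul_assoc, Matrix.mul_apply]
    refine Eq.trans ?_ h'
    simp only [WithLp.ofLp_sum, Finset.sum_apply, PiLp.smul_apply, smul_eq_mul]
    refine Finset.sum_congr rfl fun j _ => ?_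
    rw [mul_comm, Matrix.mul_apply, PiLp.inner_apply]
    congr 1
    refine Finset.sum_congr rfl fun i' _ => ?_
    simp [U, mul_comm]
  refine ⟨U * J, ?_, ?_, ?_⟩
  · refine (Matrix.l2_opNorm_mul U J).trans ?_
    have h1 := l2_opNorm_le_one_of_transpose_mul_self hU
    have h2 : ‖J‖ ≤ 1 := by
      rw [← l2_opNorm_transpose]
      exact l2_opNorm_le_one_of_transpose_mul_self (by rwa [Matrix.transpose_transpose])
    exact mul_le_one₀ h1 (norm_nonneg _) h2
  · intro i j hj
    rw [Matrix.mul_apply]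
    refine Finset.sum_eq_zero fun c _ => ?_
    have : (c : ℕ) ≠ j := by
      have := c.2
      omega
    simp [J, this]
  · rw [Matrix.transpose_mul, Matrix.mul_assoc U, ← Matrix.mul_assoc J, hJ, Matrix.one_mul, hUX]

end LatentTensor

/-! ### Norming sets for tensors of bounded Tucker rank -/

namespace LatentTensor

/-- A `1/2`-separated subset of maximal cardinality is a `1/2`-net; doubling it gives a
`1`-separated set in the ball of radius `2`, to which the bound `5 ^ dim` applies. -/
theorem exists_net_unitBall (W : Type*) [NormedAddCommGroup W] [NormedSpace ℝ W]
    [FiniteDimensional ℝ W] : ∃ N : Finset W, N.card ≤ 5 ^ Module.finrank ℝ W ∧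
      (∀ x ∈ N, ‖x‖ ≤ 1) ∧ ∀ x : W, ‖x‖ ≤ 1 → ∃ c ∈ N, ‖x - c‖ ≤ 1 / 2 := by
  classical
  let P : Set ℕ := {n | ∃ N : Finset W, N.card = n ∧ (∀ x ∈ N, ‖x‖ ≤ 1) ∧
    ∀ c ∈ N, ∀ c' ∈ N, c ≠ c' → 1 / 2 ≤ ‖c - c'‖}
  have hbd : ∀ n ∈ P, n ≤ 5 ^ Module.finrank ℝ W := by
    rintro n ⟨N, rfl, h1, h2⟩
    have h := Besicovitch.card_le_of_separated (N.image fun x => (2 : ℝ) • x)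
      (by
        intro c hc
        obtain ⟨x, hx, rfl⟩ := Finset.mem_image.1 hc
        rw [norm_smul]
        have := h1 x hx
        norm_num
        linarith)
      (by
        intro c hc c' hc' hne
        obtain ⟨x, hx, rfl⟩ := Finset.mem_image.1 hc
        obtain ⟨y, hy, rfl⟩ := Finset.mem_image.1 hc'
        have := h2 x hx y hy (fun h => hne (by rw [h]))
        rw [← smul_sub, norm_smul]
        norm_num
        linarith)
    rwa [Finset.card_image_of_injective _ (smul_right_injective W (two_ne_zero (α := ℝ)))] at h
  have hne : P.Nonempty := ⟨0, ∅, by simp⟩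
  have hbdd : BddAbove P := ⟨_, hbd⟩
  obtain ⟨N, hN, h1, h2⟩ := Nat.sSup_mem hne hbdd
  refine ⟨N, hN ▸ hbd _ (Nat.sSup_mem hne hbdd), h1, fun x hx => ?_⟩
  by_contra! hcon
  have hxN : x ∉ N := fun h => by
    have := hcon x h
    rw [sub_self, norm_zero] at this
    norm_num at this
  have hmem : N.card + 1 ∈ P := by
    refine ⟨insert x N, Finset.card_insert_of_notMem hxN, ?_, ?_⟩
    · intro y hy
      rcases Finset.mem_insert.1 hy with rfl | hy
      · exact hx
      · exact h1 y hy
    · intro c hc c' hc' hne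
      rcases Finset.mem_insert.1 hc with rfl | hcN <;>
        rcases Finset.mem_insert.1 hc' with rfl | hcN'
      · exact absurd rfl hne
      · exact (hcon _ hcN').le
      · rw [norm_sub_rev]
        exact (hcon _ hcN).le
      · exact h2 c hcN c' hcN' hne
  have := le_csSup hbdd hmem
  omega

theorem exists_norming_finset (W : Type*) [NormedAddCommGroup W] [NormedSpace ℝ W]
    [FiniteDimensional ℝ W] : ∃ N : Finset W, N.card ≤ 5 ^ Module.finrank ℝ W ∧
      (∀ x ∈ N, ‖x‖ ≤ 1) ∧ ∀ (φ : W →ₗ[ℝ] ℝ) (t : ℝ), (∀ x ∈ N, |φ x| ≤ t) →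
        ∀ x : W, ‖x‖ ≤ 1 → |φ x| ≤ 2 * t := by
  obtain ⟨N, hc, h1, h2⟩ := exists_net_unitBall W
  refine ⟨N, hc, h1, fun φ t ht x hx => ?_⟩
  have ht0 : 0 ≤ t := by
    obtain ⟨c, hc, -⟩ := h2 0 (by simp)
    exact (abs_nonneg _).trans (ht c hc)
  set ψ : W →L[ℝ] ℝ := LinearMap.toContinuousLinearMap φ with hψ
  -- Approximating a unit vector by the net costs half of the norm, which is then absorbed on the
  -- left.
  have hle : ‖ψ‖ ≤ t + ‖ψ‖ / 2 := by
    refine ContinuousLinearMap.opNorm_le_of_unit_norm (by positivity) fun y hy => ?_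
    obtain ⟨c, hc, hyc⟩ := h2 y hy.le
    have h3 : ψ y = ψ c + ψ (y - c) := by simp
    rw [h3]
    refine (norm_add_le _ _).trans (add_le_add (ht c hc) ?_)
    refine (ψ.le_opNorm _).trans ?_
    nlinarith [norm_nonneg ψ]
  have h4 : ‖ψ x‖ ≤ ‖ψ‖ := ψ.unit_le_opNorm x hx
  have h5 : |φ x| ≤ ‖ψ‖ := h4
  linarith

/-- At most `5 ^ n` vectors of the unit ball control each linear functional on `C` up to the
factor `K`. -/
def HasNorming {V : Type*} [NormedAddCommGroup V] [NormedSpace ℝ V] (C : Set V) (n : ℕ) (K : ℝ) :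
    Prop :=
  ∃ N : Finset V, N.card ≤ 5 ^ n ∧ (∀ x ∈ N, ‖x‖ ≤ 1) ∧ ∀ (φ : V →ₗ[ℝ] ℝ) (t : ℝ),
    (∀ x ∈ N, |φ x| ≤ t) → ∀ x ∈ C, |φ x| ≤ K * t

variable {V : Type*} [NormedAddCommGroup V] [NormedSpace ℝ V]

theorem HasNorming.mono {C C' : Set V} {n n' : ℕ} {K : ℝ} (h : HasNorming C n K) (hC : C' ⊆ C)
    (hn : n ≤ n') : HasNorming C' n' K := by
  obtain ⟨N, hc, h1, h2⟩ := h
  exact ⟨N, hc.trans (Nat.pow_le_pow_right (by norm_num) hn), h1,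
    fun φ t ht x hx => h2 φ t ht x (hC hx)⟩

theorem hasNorming_submodule (W : Submodule ℝ V) [FiniteDimensional ℝ W] :
    HasNorming {x | x ∈ W ∧ ‖x‖ ≤ 1} (Module.finrank ℝ W) 2 := by
  classical
  obtain ⟨N, hc, h1, h2⟩ := exists_norming_finset W
  refine ⟨N.image W.subtype, Finset.card_image_le.trans hc, ?_, ?_⟩
  · intro x hx
    obtain ⟨y, hy, rfl⟩ := Finset.mem_image.1 hx
    exact h1 y hy
  · rintro φ t ht x ⟨hxW, hx⟩
    exact h2 (φ ∘ₗ W.subtype) t (fun y hy => ht _ (Finset.mem_image_of_mem _ hy)) ⟨x, hxW⟩ hx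

/-- Bilinearity: for fixed `B` in the net of `W`, pass from test vectors to all of `C`; then fix `x`
and pass from the net to all `A`. Exponents add and constants multiply. -/
theorem HasNorming.image2 {W : Type*} [NormedAddCommGroup W] [NormedSpace ℝ W]
    [FiniteDimensional ℝ W] {C : Set V} {n : ℕ} {K : ℝ} (hC : HasNorming C n K)
    (L : W →ₗ[ℝ] V →ₗ[ℝ] V) (hL : ∀ A x, ‖L A x‖ ≤ ‖A‖ * ‖x‖) :
    HasNorming {y | ∃ A : W, ‖A‖ ≤ 1 ∧ ∃ x ∈ C, L A x = y} (n + Module.finrank ℝ W) (2 * K) := by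
  classical
  obtain ⟨N, hc, h1, h2⟩ := hC
  obtain ⟨N', hc', h1', h2'⟩ := exists_norming_finset W
  refine ⟨Finset.image₂ (fun A x => L A x) N' N, ?_, ?_, ?_⟩
  · refine (Finset.card_image₂_le _ _ _).trans ?_
    rw [pow_add, mul_comm]
    exact Nat.mul_le_mul hc hc'
  · intro y hy
    obtain ⟨A, hA, x, hx, rfl⟩ := Finset.mem_image₂.1 hy
    exact (hL A x).trans (mul_le_one₀ (h1' A hA) (norm_nonneg _) (h1 x hx))
  · rintro φ t ht y ⟨A, hA, x, hx, rfl⟩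
    have := h2' (φ ∘ₗ L.flip x) (K * t) (fun B hB =>
      h2 (φ ∘ₗ L B) t (fun z hz => ht _ (Finset.mem_image₂_of_mem hB hz)) x hx) A hA
    simpa [mul_assoc] using this

variable {m : ℕ} {d : Fin m → ℕ}

/-- The product of a tensor with a square matrix along mode `k`. -/
noncomputable def modeMul (k : Fin m) : Matrix (Fin (d k)) (Fin (d k)) ℝ →ₗ[ℝ]
    EuclideanSpace ℝ ((k : Fin m) → Fin (d k)) →ₗ[ℝ] EuclideanSpace ℝ ((k : Fin m) → Fin (d k)) :=
  LinearMap.mk₂ ℝ (fun A T => WithLp.toLp 2 fun i => ∑ a, A (i k) a * T (Function.update i k a))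
    (fun A B T => by ext i; simp [add_mul, Finset.sum_add_distrib])
    (fun c A T => by ext i; simp [Finset.mul_sum, mul_assoc])
    (fun A S T => by ext i; simp [mul_add, Finset.sum_add_distrib])
    (fun c A T => by ext i; simp [Finset.mul_sum, mul_left_comm])

theorem modeMul_apply (k : Fin m) (A : Matrix (Fin (d k)) (Fin (d k)) ℝ)
    (T : EuclideanSpace ℝ ((k : Fin m) → Fin (d k))) (i) :
    modeMul k A T i = ∑ a, A (i k) a * T (Function.update i k a) := rfl

theorem unfold_modeMul (k : Fin m) (A : Matrix (Fin (d k)) (Fin (d k)) ℝ)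
    (T : EuclideanSpace ℝ ((k : Fin m) → Fin (d k))) :
    unfold k (modeMul k A T).ofLp = A * unfold k T.ofLp := by
  ext a b
  rw [Matrix.mul_apply, unfold, Matrix.of_apply, modeMul_apply]
  refine Finset.sum_congr rfl fun c _ => ?_
  rw [unfold, Matrix.of_apply]
  have h1 : (Equiv.piSplitAt k fun j => Fin (d j)).symm (a, b) k = a := by simp
  have h2 : Function.update ((Equiv.piSplitAt k fun j => Fin (d j)).symm (a, b)) k c =
      (Equiv.piSplitAt k fun j => Fin (d j)).symm (c, b) := by
    funext j
    by_cases h : j = k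
    · subst h
      simp
    · simp [h]
  rw [h1, h2]

theorem modeMul_mul (k : Fin m) (A B : Matrix (Fin (d k)) (Fin (d k)) ℝ)
    (T : EuclideanSpace ℝ ((k : Fin m) → Fin (d k))) :
    modeMul k (A * B) T = modeMul k A (modeMul k B T) := by
  have h := unfold_injective (d := d) k
  refine WithLp.ofLp_injective 2 (h ?_)
  rw [unfold_modeMul, unfold_modeMul, unfold_modeMul, Matrix.mul_assoc]

theorem modeMul_comm {k l : Fin m} (hkl : k ≠ l) (A : Matrix (Fin (d k)) (Fin (d k)) ℝ)
    (B : Matrix (Fin (d l)) (Fin (d l)) ℝ) (T : EuclideanSpace ℝ ((k : Fin m) → Fin (d k))) :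
    modeMul k A (modeMul l B T) = modeMul l B (modeMul k A T) := by
  ext i
  simp only [modeMul_apply, Finset.mul_sum]
  rw [Finset.sum_comm]
  refine Finset.sum_congr rfl fun b _ => Finset.sum_congr rfl fun a _ => ?_
  rw [Function.update_of_ne hkl.symm, Function.update_of_ne hkl, Function.update_comm hkl]
  ring

theorem norm_sq_eq_sum_unfold (k : Fin m) (T : EuclideanSpace ℝ ((k : Fin m) → Fin (d k))) :
    ‖T‖ ^ 2 = ∑ b, ‖(WithLp.toLp 2 ((unfold k T.ofLp).col b) : EuclideanSpace ℝ (Fin (d k)))‖ ^ 2 := by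
  simp only [EuclideanSpace.norm_sq_eq]
  rw [Finset.sum_comm, ← Fintype.sum_prod_type',
    ← (Equiv.piSplitAt k fun j => Fin (d j)).symm.sum_comp]
  rfl

open scoped Matrix.Norms.L2Operator

theorem norm_modeMul_le (k : Fin m) (A : Matrix (Fin (d k)) (Fin (d k)) ℝ)
    (T : EuclideanSpace ℝ ((k : Fin m) → Fin (d k))) : ‖modeMul k A T‖ ≤ ‖A‖ * ‖T‖ := by
  refine le_of_sq_le_sq ?_ (by positivity)
  rw [mul_pow, norm_sq_eq_sum_unfold k, norm_sq_eq_sum_unfold k T, Finset.mul_sum]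
  refine Finset.sum_le_sum fun b _ => ?_
  rw [← mul_pow]
  refine pow_le_pow_left₀ (norm_nonneg _) ?_ 2
  have := Matrix.l2_opNorm_mulVec A (WithLp.toLp 2 ((unfold k T.ofLp).col b))
  rw [unfold_modeMul]
  exact this

/-- The square matrices of size `n` with all columns from the `R`-th on equal to zero. -/
def colSupported (n R : ℕ) : Submodule ℝ (Matrix (Fin n) (Fin n) ℝ) where
  carrier := {A | ∀ i (j : Fin n), R ≤ (j : ℕ) → A i j = 0}
  add_mem' hA hB i j h := by simp [hA i j h, hB i j h]
  zero_mem' _ _ _ := rfl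
  smul_mem' c A hA i j h := by simp [hA i j h]

theorem finrank_colSupported_le (n R : ℕ) : Module.finrank ℝ (colSupported n R) ≤ n * R := by
  let φ : colSupported n R →ₗ[ℝ] (Fin n × Fin R → ℝ) :=
    { toFun := fun A p => if h : (p.2 : ℕ) < n then A.1 p.1 ⟨p.2, h⟩ else 0
      map_add' := fun A B => by
        funext p
        by_cases h : (p.2 : ℕ) < n <;> simp [h]
      map_smul' := fun c A => by
        funext p
        by_cases h : (p.2 : ℕ) < n <;> simp [h] }
  have hφ : Function.Injective φ := by
    intro A B h
    refine Subtype.ext (Matrix.ext fun i j => ?_)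
    by_cases hj : (j : ℕ) < R
    · have := congrFun h (i, ⟨j, hj⟩)
      simpa [φ] using this
    · rw [A.2 i j (by omega), B.2 i j (by omega)]
  have := LinearMap.finrank_le_finrank_of_injective hφ
  simpa using this

/-- The tensors supported on the indices all of whose entries are less than `R`. -/
def cornerSupported (d : Fin m → ℕ) (R : ℕ) :
    Submodule ℝ (EuclideanSpace ℝ ((k : Fin m) → Fin (d k))) where
  carrier := {T | ∀ i k, R ≤ (i k : ℕ) → T i = 0}
  add_mem' hA hB i k h := by simp [hA i k h, hB i k h]
  zero_mem' _ _ _ := rfl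
  smul_mem' c A hA i k h := by simp [hA i k h]

theorem finrank_cornerSupported_le (d : Fin m → ℕ) (R : ℕ) :
    Module.finrank ℝ (cornerSupported d R) ≤ R ^ m := by
  classical
  let φ : cornerSupported d R →ₗ[ℝ] ((Fin m → Fin R) → ℝ) :=
    { toFun := fun T p => if h : ∀ k, (p k : ℕ) < d k then T.1 (fun k => ⟨p k, h k⟩) else 0
      map_add' := fun A B => by
        funext p
        by_cases h : ∀ k, (p k : ℕ) < d k <;> simp [h]
      map_smul' := fun c A => by
        funext p
        by_cases h : ∀ k, (p k : ℕ) < d k <;> simp [h] }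
  have hφ : Function.Injective φ := by
    intro A B h
    refine Subtype.ext (PiLp.ext fun i => ?_)
    by_cases hj : ∀ k, (i k : ℕ) < R
    · have := congrFun h fun k => ⟨i k, hj k⟩
      simpa [φ] using this
    · push Not at hj
      obtain ⟨k, hk⟩ := hj
      rw [A.2 i k hk, B.2 i k hk]
  have := LinearMap.finrank_le_finrank_of_injective hφ
  simpa using this

/-- The tensors obtained from a core tensor in the unit ball, supported on indices less than `R`,
by multiplication along the modes in the list by contractions with at most `R` nonzero columns. -/
def tuckerClass (d : Fin m → ℕ) (R : ℕ) :
    List (Fin m) → Set (EuclideanSpace ℝ ((k : Fin m) → Fin (d k)))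
  | [] => {x | x ∈ cornerSupported d R ∧ ‖x‖ ≤ 1}
  | k :: l => {y | ∃ A : colSupported (d k) R, ‖A‖ ≤ 1 ∧ ∃ x ∈ tuckerClass d R l,
      ((modeMul k).domRestrict (colSupported (d k) R)) A x = y}

theorem hasNorming_tuckerClass (d : Fin m → ℕ) (R : ℕ) (l : List (Fin m)) :
    HasNorming (tuckerClass d R l) (R ^ m + l.length * (R * dimMax d)) (2 * 2 ^ l.length) := by
  induction l with
  | nil =>
    have := hasNorming_submodule (cornerSupported d R)
    simpa [tuckerClass] using this.mono subset_rfl (finrank_cornerSupported_le d R)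
  | cons k l ih =>
    have := ih.image2 ((modeMul k).domRestrict (colSupported (d k) R))
      (fun A x => norm_modeMul_le k A.1 x)
    have h2 := this.mono subset_rfl (n' := R ^ m + (l.length + 1) * (R * dimMax d)) (by
      have h3 := finrank_colSupported_le (d k) R
      have h4 : d k * R ≤ R * dimMax d := by
        rw [mul_comm]
        exact Nat.mul_le_mul_left _ (le_dimMax d k)
      rw [add_mul, one_mul]
      omega)
    have h5 : 2 * (2 * (2 : ℝ) ^ l.length) = 2 * 2 ^ (l.length + 1) := by ring
    rw [h5] at h2
    exact h2

/-- Peel off one mode at a time: `T = A Aᵀ T` along mode `k`, and `Aᵀ T` is supported below `R`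
there. Products along distinct modes commute, so the later modes remain fixed by their projections.
-/
theorem mem_tuckerClass {R : ℕ} {A : ∀ k, Matrix (Fin (d k)) (Fin (d k)) ℝ} (hA : ∀ k, ‖A k‖ ≤ 1)
    (hAR : ∀ k, A k ∈ colSupported (d k) R) (l : List (Fin m)) (hl : l.Nodup)
    (T : EuclideanSpace ℝ ((k : Fin m) → Fin (d k))) (hT : ‖T‖ ≤ 1)
    (hfix : ∀ k ∈ l, modeMul k (A k * (A k).transpose) T = T)
    (hsupp : ∀ k ∉ l, ∀ i, R ≤ (i k : ℕ) → T i = 0) : T ∈ tuckerClass d R l := by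
  induction l generalizing T with
  | nil => exact ⟨fun i k h => hsupp k (by simp) i h, hT⟩
  | cons k l ih =>
    rw [List.nodup_cons] at hl
    refine ⟨⟨A k, hAR k⟩, hA k, modeMul k (A k).transpose T, ih hl.2 _ ?_ ?_ ?_, ?_⟩
    · refine (norm_modeMul_le _ _ _).trans (mul_le_one₀ ?_ (norm_nonneg _) hT)
      rw [l2_opNorm_transpose]
      exact hA k
    · intro j hj
      have hjk : j ≠ k := fun h => hl.1 (h ▸ hj)
      rw [modeMul_comm hjk, hfix j (List.mem_cons_of_mem _ hj)]
    · intro j hj i hi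
      rw [modeMul_apply]
      refine Finset.sum_eq_zero fun a _ => ?_
      by_cases hjk : j = k
      · subst hjk
        rw [Matrix.transpose_apply, hAR j a (i j) hi, zero_mul]
      · rw [hsupp j (by simp [hj, hjk]) _ (by rwa [Function.update_of_ne hjk]), mul_zero]
    · have := hfix k List.mem_cons_self
      rw [modeMul_mul] at this
      exact this

theorem TuckerRankLE.mem_tuckerClass {R : ℕ} {T : EuclideanSpace ℝ ((k : Fin m) → Fin (d k))}
    (hT : TuckerRankLE R T.ofLp) (h1 : ‖T‖ ≤ 1) : T ∈ tuckerClass d R (List.finRange m) := by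
  choose A hA hAR hfix using fun k => exists_partialIsometry_of_rank_le (hT k)
  refine LatentTensor.mem_tuckerClass hA hAR _ (List.nodup_finRange m) T h1 (fun k _ => ?_)
    (fun k hk => absurd (List.mem_finRange k) hk)
  refine WithLp.ofLp_injective 2 (unfold_injective k ?_)
  rw [unfold_modeMul, hfix]

theorem hasNorming_tuckerRankLE (d : Fin m → ℕ) (R : ℕ) :
    HasNorming {T : EuclideanSpace ℝ ((k : Fin m) → Fin (d k)) | TuckerRankLE R T.ofLp ∧ ‖T‖ ≤ 1}
      (R ^ m + m * (R * dimMax d)) (2 * 2 ^ m) := by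
  have := hasNorming_tuckerClass d R (List.finRange m)
  rw [List.length_finRange] at this
  exact this.mono (fun T hT => hT.1.mem_tuckerClass hT.2) le_rfl

end LatentTensor

/-! ### Gaussian concentration and the least-squares error -/

namespace LatentTensor

open MeasureTheory ProbabilityTheory

theorem hasSubgaussianMGF_of_hasLaw_gaussianReal {Ω : Type*} [MeasurableSpace Ω] {μ : Measure Ω}
    {X : Ω → ℝ} (hX : HasLaw X (gaussianReal 0 1) μ) : HasSubgaussianMGF X 1 μ := by
  refine HasSubgaussianMGF.of_map (μ := μ) (X := fun x => x) hX.aemeasurable ?_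
  rw [hX.map_eq]
  refine ⟨fun t => integrable_exp_mul_gaussianReal t, fun t => le_of_eq ?_⟩
  have := congrFun (mgf_fun_id_gaussianReal (μ := 0) (v := 1)) t
  rw [this]
  simp

variable {m : ℕ} {d : Fin m → ℕ}

theorem IsGaussianNoise.hasSubgaussianMGF_inner {Ω : Type*} [MeasurableSpace Ω] {μ : Measure Ω}
    [IsProbabilityMeasure μ] {E : Ω → Tensor d} (hE : IsGaussianNoise μ E)
    {x : EuclideanSpace ℝ ((k : Fin m) → Fin (d k))} (hx : ‖x‖ ≤ 1) :
    HasSubgaussianMGF (fun ω => inner ℝ (WithLp.toLp 2 (E ω)) x) 1 μ := by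
  have h1 : iIndepFun (fun i ω => x i * E ω i) μ :=
    hE.1.comp (fun i y => x i * y) fun i => by fun_prop
  have h0 : ∀ i, HasSubgaussianMGF (fun ω => x i * E ω i) (Real.toNNReal (x i ^ 2)) μ := by
    intro i
    convert (hasSubgaussianMGF_of_hasLaw_gaussianReal (hE.2 i)).const_mul (x i) using 1
    exact (Real.toNNReal_of_nonneg (sq_nonneg _)).trans (mul_one _).symm
  have h2 := HasSubgaussianMGF.sum_of_iIndepFun h1 (s := Finset.univ) fun i _ => h0 i
  have h3 : (fun ω => inner ℝ (WithLp.toLp 2 (E ω)) x) = fun ω => ∑ i, x i * E ω i := by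
    funext ω
    simp [PiLp.inner_apply]
  rw [h3]
  refine ⟨h2.1, fun t => (h2.2 t).trans (Real.exp_le_exp.2 ?_)⟩
  have h4 : ∑ i, x i ^ 2 ≤ 1 := by
    have := EuclideanSpace.norm_sq_eq x
    simp only [Real.norm_eq_abs, sq_abs] at this
    rw [← this]
    exact pow_le_one₀ (norm_nonneg _) hx
  have h5 : ((∑ i, Real.toNNReal (x i ^ 2) : NNReal) : ℝ) = ∑ i, x i ^ 2 := by
    rw [NNReal.coe_sum]
    exact Finset.sum_congr rfl fun i _ => Real.coe_toNNReal _ (sq_nonneg _)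
  rw [h5, NNReal.coe_one]
  have := mul_le_mul_of_nonneg_right h4 (sq_nonneg t)
  linarith

theorem IsGaussianNoise.measure_abs_inner_le {Ω : Type*} [MeasurableSpace Ω] {μ : Measure Ω}
    [IsProbabilityMeasure μ] {E : Ω → Tensor d} (hE : IsGaussianNoise μ E)
    {x : EuclideanSpace ℝ ((k : Fin m) → Fin (d k))} (hx : ‖x‖ ≤ 1) {t : ℝ} (ht : 0 ≤ t) :
    μ {ω | t < |inner ℝ (WithLp.toLp 2 (E ω)) x|} ≤ ENNReal.ofReal (2 * Real.exp (-t ^ 2 / 2)) := by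
  have h1 := (hE.hasSubgaussianMGF_inner hx).measure_ge_le ht
  have h2 := (hE.hasSubgaussianMGF_inner hx).neg.measure_ge_le ht
  rw [NNReal.coe_one, mul_one] at h1 h2
  have hsub : {ω | t < |inner ℝ (WithLp.toLp 2 (E ω)) x|} ⊆
      {ω | t ≤ inner ℝ (WithLp.toLp 2 (E ω)) x} ∪
        {ω | t ≤ (-fun ω => inner ℝ (WithLp.toLp 2 (E ω)) x) ω} := by
    intro ω hω
    have hω' : t < |inner ℝ (WithLp.toLp 2 (E ω)) x| := hω
    rcases lt_abs.1 hω' with h | h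
    · exact Or.inl h.le
    · exact Or.inr h.le
  refine (measure_mono hsub).trans ((measure_union_le _ _).trans ?_)
  rw [two_mul, ENNReal.ofReal_add (by positivity) (by positivity)]
  refine add_le_add ?_ ?_
  · rw [← ofReal_measureReal]
    exact ENNReal.ofReal_le_ofReal h1
  · rw [← ofReal_measureReal]
    exact ENNReal.ofReal_le_ofReal h2

theorem five_le_exp_two : (5 : ℝ) ≤ Real.exp 2 := by
  have h : Real.exp 2 = Real.exp 1 * Real.exp 1 := by
    rw [← Real.exp_add]
    norm_num
  rw [h]
  nlinarith [Real.exp_one_gt_d9]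

/-- Union bound over the norming set: at level `√(6n)` each tail is `2 * exp (-3n)`, against `5 ^ n
≤ exp (2n)` vectors. -/
theorem IsGaussianNoise.measure_sup_inner_le {Ω : Type*} [MeasurableSpace Ω] {μ : Measure Ω}
    [IsProbabilityMeasure μ] {E : Ω → Tensor d} (hE : IsGaussianNoise μ E)
    {C : Set (EuclideanSpace ℝ ((k : Fin m) → Fin (d k)))} {n : ℕ} {K : ℝ}
    (hC : HasNorming C n K) :
    μ {ω | ¬ ∀ x ∈ C, |inner ℝ (WithLp.toLp 2 (E ω)) x| ≤ K * Real.sqrt (6 * n)} ≤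
      ENNReal.ofReal (2 * Real.exp (-n)) := by
  obtain ⟨N, hN, h1, h2⟩ := hC
  have hsub : {ω | ¬ ∀ x ∈ C, |inner ℝ (WithLp.toLp 2 (E ω)) x| ≤ K * Real.sqrt (6 * n)} ⊆
      ⋃ x ∈ N, {ω | Real.sqrt (6 * n) < |inner ℝ (WithLp.toLp 2 (E ω)) x|} := by
    intro ω hω
    by_contra hcon
    simp only [Set.mem_iUnion, not_exists] at hcon
    refine hω (h2 (innerSL ℝ (WithLp.toLp 2 (E ω))).toLinearMap _ fun x hx => ?_)
    exact not_lt.1 (hcon x hx)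
  refine (measure_mono hsub).trans ((measure_biUnion_finset_le _ _).trans ?_)
  refine (Finset.sum_le_sum fun x hx =>
    hE.measure_abs_inner_le (h1 x hx) (Real.sqrt_nonneg _)).trans ?_
  rw [Finset.sum_const, ← ENNReal.ofReal_nsmul]
  refine ENNReal.ofReal_le_ofReal ?_
  rw [nsmul_eq_mul, Real.sq_sqrt (by positivity)]
  have h3 : (N.card : ℝ) ≤ Real.exp (2 * n) := by
    calc (N.card : ℝ) ≤ 5 ^ n := by exact_mod_cast hN
      _ ≤ Real.exp 2 ^ n := pow_le_pow_left₀ (by norm_num) five_le_exp_two n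
      _ = Real.exp (2 * n) := by rw [← Real.exp_nat_mul, mul_comm]
  calc (N.card : ℝ) * (2 * Real.exp (-(6 * n) / 2))
      ≤ Real.exp (2 * n) * (2 * Real.exp (-(6 * n) / 2)) := by gcongr
    _ = 2 * Real.exp (-n) := by
      rw [mul_left_comm, ← Real.exp_add]
      ring_nf

/-- Expanding the square gives `‖T - X‖² ≤ 2⟪e + (Θ - X), T - X⟫`. The competitor is `X`, since `Θ`
itself need not have low rank. -/
theorem norm_sub_sq_le_of_basic_inequality {V : Type*} [NormedAddCommGroup V]
    [InnerProductSpace ℝ V] {e Θ X T : V} {K : ℝ} (hK : 0 ≤ K)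
    (h : ‖Θ + e - T‖ ≤ ‖Θ + e - X‖) (hn : |inner ℝ e (T - X)| ≤ K * ‖T - X‖) :
    ‖T - Θ‖ ^ 2 ≤ 8 * K ^ 2 + 18 * ‖Θ - X‖ ^ 2 := by
  have h1 : Θ + e - T = (Θ + e - X) - (T - X) := by abel
  have h2 := norm_sub_sq_real (Θ + e - X) (T - X)
  rw [← h1] at h2
  have h3 : Θ + e - X = e + (Θ - X) := by abel
  have h4 : inner ℝ (Θ + e - X) (T - X) = inner ℝ e (T - X) + inner ℝ (Θ - X) (T - X) := by
    rw [h3, inner_add_left]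
  have h5 := real_inner_le_norm (Θ - X) (T - X)
  have h6 := (abs_le.1 hn).2
  have h7 := pow_le_pow_left₀ (norm_nonneg _) h 2
  have h8 : ‖T - X‖ * ‖T - X‖ ≤ ‖T - X‖ * (2 * K + 2 * ‖Θ - X‖) := by nlinarith
  have h9 : ‖T - X‖ ≤ 2 * K + 2 * ‖Θ - X‖ := by
    rcases (norm_nonneg (T - X)).eq_or_lt with h0 | h0
    · rw [← h0]
      positivity
    · exact le_of_mul_le_mul_left h8 h0
  have h10 : ‖T - Θ‖ ≤ 2 * K + 3 * ‖Θ - X‖ := by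
    have h11 : T - Θ = (T - X) - (Θ - X) := by abel
    have := norm_sub_le (T - X) (Θ - X)
    rw [← h11] at this
    linarith
  have h12 := pow_le_pow_left₀ (norm_nonneg _) h10 2
  nlinarith [sq_nonneg (2 * K - 3 * ‖Θ - X‖)]

theorem abs_inner_le_of_tuckerRankLE {R : ℕ} {e T : EuclideanSpace ℝ ((k : Fin m) → Fin (d k))}
    {K : ℝ} (hK : ∀ x ∈ {T : EuclideanSpace ℝ ((k : Fin m) → Fin (d k)) |
      TuckerRankLE R T.ofLp ∧ ‖T‖ ≤ 1}, |inner ℝ e x| ≤ K) (hT : TuckerRankLE R T.ofLp) :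
    |inner ℝ e T| ≤ K * ‖T‖ := by
  rcases eq_or_ne T 0 with rfl | h0
  · simp
  have hpos : 0 < ‖T‖ := norm_pos_iff.2 h0
  have := hK (‖T‖⁻¹ • T) ⟨hT.smul _, by rw [norm_smul, norm_inv, norm_norm, inv_mul_cancel₀ hpos.ne']⟩
  rw [inner_smul_right, abs_mul, abs_of_pos (inv_pos.2 hpos), inv_mul_le_iff₀ hpos] at this
  linarith

theorem frobNorm_sq_le_of_abs_le {T : Tensor d} {b : ℝ} (hb : ∀ i, |T i| ≤ b) :
    frobNorm T ^ 2 ≤ dimProd d * b ^ 2 := by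
  rw [frobNorm, Real.sq_sqrt (Finset.sum_nonneg fun _ _ => sq_nonneg _)]
  refine (Finset.sum_le_sum fun i _ =>
    (sq_abs (T i)).symm.trans_le (pow_le_pow_left₀ (abs_nonneg _) (hb i) 2)).trans (le_of_eq ?_)
  simp [dimProd]

theorem eq_zero_of_tuckerRankLE_zero (hm : 1 ≤ m) {T : Tensor d} (hT : TuckerRankLE 0 T) : T = 0 := by
  have h := Nat.le_zero.1 (hT ⟨0, hm⟩)
  rw [Matrix.rank, Submodule.finrank_eq_zero, LinearMap.range_eq_bot] at h
  classical
  refine unfold_injective ⟨0, hm⟩ (Matrix.ext fun a b => ?_)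
  have := congrFun (LinearMap.congr_fun h (Pi.single b 1)) a
  simp only [Matrix.mulVecLin_apply, Matrix.mulVec_single_one, LinearMap.zero_apply,
    Pi.zero_apply] at this
  exact this

theorem lse_error_le {r : ℕ} {e Θ X T : Tensor d} {A b K : ℝ} (hK : 0 ≤ K)
    (hX : TuckerRankLE r X) (hΘX : ∀ i, |Θ i - X i| ≤ A * Real.exp (-b)) (hb : 0 ≤ b)
    (hT : IsLSE r (Θ + e) T)
    (he : ∀ x ∈ {T : EuclideanSpace ℝ ((k : Fin m) → Fin (d k)) |
      TuckerRankLE (2 * r) T.ofLp ∧ ‖T‖ ≤ 1}, |inner ℝ (WithLp.toLp 2 e) x| ≤ K) :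
    frobNorm (T - Θ) ^ 2 ≤ 8 * K ^ 2 + 18 * A ^ 2 * (dimProd d * Real.exp (-b)) := by
  have h1 := hT.2 X hX
  rw [frobNorm_eq_norm, frobNorm_eq_norm] at h1
  have h2 : TuckerRankLE (2 * r) (T - X) := by
    rw [two_mul]
    exact hT.1.sub hX
  have h3 := abs_inner_le_of_tuckerRankLE he (T := WithLp.toLp 2 (T - X)) h2
  have h4 := norm_sub_sq_le_of_basic_inequality (e := WithLp.toLp 2 e) (Θ := WithLp.toLp 2 Θ)
    (X := WithLp.toLp 2 X) (T := WithLp.toLp 2 T) hK h1 h3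
  have h5 : ‖(WithLp.toLp 2 Θ - WithLp.toLp 2 X : EuclideanSpace ℝ ((k : Fin m) → Fin (d k)))‖ ^ 2 ≤
      dimProd d * (A * Real.exp (-b)) ^ 2 := by
    have := frobNorm_sq_le_of_abs_le (T := Θ - X) hΘX
    rwa [frobNorm_eq_norm] at this
  have h6 : Real.exp (-b) ^ 2 ≤ Real.exp (-b) := by
    have : Real.exp (-b) ≤ 1 := Real.exp_le_one_iff.2 (by linarith)
    nlinarith [Real.exp_pos (-b)]
  have h7 : (dimProd d : ℝ) * (A * Real.exp (-b)) ^ 2 ≤ A ^ 2 * (dimProd d * Real.exp (-b)) := by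
    calc (dimProd d : ℝ) * (A * Real.exp (-b)) ^ 2 = A ^ 2 * (dimProd d * Real.exp (-b) ^ 2) := by ring
      _ ≤ _ := by gcongr
  rw [frobNorm_eq_norm]
  have h8 : ‖(WithLp.toLp 2 (T - Θ) : EuclideanSpace ℝ ((k : Fin m) → Fin (d k)))‖ ^ 2 ≤
    8 * K ^ 2 + 18 * ‖(WithLp.toLp 2 Θ - WithLp.toLp 2 X :
      EuclideanSpace ℝ ((k : Fin m) → Fin (d k)))‖ ^ 2 := h4
  linarith

theorem tuckerComplexity_le (d : Fin m → ℕ) (r : ℕ) :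
    (((2 * r) ^ m + m * (2 * r * dimMax d) : ℕ) : ℝ) ≤
      (2 ^ m + 2 * m) * ((r : ℝ) ^ m + r * dimMax d) := by
  push_cast
  rw [mul_pow]
  have h1 : (0 : ℝ) ≤ 2 * m * (r : ℝ) ^ m := by positivity
  have h2 : (0 : ℝ) ≤ 2 ^ m * ((r : ℝ) * dimMax d) := by positivity
  linarith

theorem lse_upper_bound (hm : 1 ≤ m) {s : Fin m → ℕ} (hs : ∀ k, 1 ≤ s k) {M c : ℝ}
    (hc : IsApproxConst s M c) :
    ∃ C : ℝ, 0 < C ∧ ∀ ε : ℝ, 0 < ε → ∃ D : ℕ,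
      ∀ d : Fin m → ℕ, (∀ k, D ≤ d k) → ∀ r : ℕ,
      ∀ Θ ∈ latentModel d s M,
      ∀ (Ω : Type*) [MeasurableSpace Ω] (μ : Measure Ω)
        [IsProbabilityMeasure μ] (E : Ω → Tensor d), IsGaussianNoise μ E →
      ∀ That : Ω → Tensor d, (∀ ω, IsLSE r (Θ + E ω) (That ω)) →
        μ {ω | ¬ frobNorm (That ω - Θ) ^ 2 ≤ C * lseRate d s c r} ≤ ENNReal.ofReal ε := by
  obtain ⟨hc0, A, hA⟩ := hc
  -- `192 = 8 * 4 * 6`: the `8 * K ^ 2` of `lse_error_le` with `K = 2 * 2 ^ m * √(6n)`.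
  refine ⟨192 * 4 ^ m * (2 ^ m + 2 * m) + 18 * A ^ 2 + 1, by positivity, fun ε hε => ?_⟩
  obtain ⟨D, hD⟩ := exists_nat_ge (Real.log (2 / ε))
  refine ⟨D, fun d hd r Θ hΘ Ω _ μ _ E hE That hT => ?_⟩
  have hsb : 1 ≤ dimMax s := (hs ⟨0, hm⟩).trans (le_dimMax s _)
  -- For `r = 0` the approximation property is silent, but the fit is `0` and the rate is at least
  -- `d_*`.
  rcases Nat.eq_zero_or_pos r with rfl | hr
  · refine le_of_eq_of_le ?_ (zero_le (a := ENNReal.ofReal ε))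
    convert measure_empty (μ := μ)
    ext ω
    simp only [Set.mem_ofPred_eq, Set.mem_empty_iff_false, iff_false, not_not]
    rw [eq_zero_of_tuckerRankLE_zero hm (hT ω).1]
    have h1 := frobNorm_sq_le_of_abs_le (T := 0 - Θ) (b := 1) fun i => by
      simpa using latentModel.abs_le_one hΘ i
    have h2 : (dimProd d : ℝ) ≤ lseRate d s c 0 := by
      rw [lseRate, Nat.cast_zero, Real.zero_rpow (by positivity), mul_zero, Real.exp_zero]
      simp
    have h3 : (0 : ℝ) ≤ dimProd d := Nat.cast_nonneg _
    have h4 : (0 : ℝ) ≤ 192 * 4 ^ m * (2 ^ m + 2 * m) + 18 * A ^ 2 := by positivity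
    nlinarith [mul_nonneg h4 (h3.trans h2)]
  · obtain ⟨X, hX, hΘX⟩ := hA d Θ hΘ r hr
    have hnet := hasNorming_tuckerRankLE d (2 * r)
    set n := (2 * r) ^ m + m * (2 * r * dimMax d) with hn
    have hsup := hE.measure_sup_inner_le hnet
    -- The failure event lies in an event about the noise alone, so `That` needs no measurability.
    refine (measure_mono ?_).trans (hsup.trans (ENNReal.ofReal_le_ofReal ?_))
    · intro ω hω hgood
      refine hω ?_
      rw [neg_mul] at hΘX
      have h1 := lse_error_le (by positivity) hX hΘX (by positivity) (hT ω) hgood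
      refine h1.trans ?_
      rw [mul_pow, Real.sq_sqrt (by positivity), lseRate, neg_mul]
      have h2 : (n : ℝ) ≤ _ := tuckerComplexity_le d r
      have h3 : (2 * 2 ^ m : ℝ) ^ 2 = 4 * 4 ^ m := by
        rw [mul_pow, ← pow_mul, mul_comm m 2, pow_mul]
        norm_num
      rw [h3]
      have h4 : 8 * (4 * 4 ^ m * (6 * (n : ℝ))) ≤
          192 * 4 ^ m * (2 ^ m + 2 * m) * ((r : ℝ) ^ m + r * dimMax d) := by
        calc 8 * (4 * 4 ^ m * (6 * (n : ℝ))) = 192 * 4 ^ m * n := by ring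
          _ ≤ 192 * 4 ^ m * ((2 ^ m + 2 * m) * ((r : ℝ) ^ m + r * dimMax d)) := by gcongr
          _ = _ := by ring
      refine (add_le_add_left h4 _).trans ?_
      generalize hq : (dimProd d : ℝ) * Real.exp _ = q
      have hq0 : 0 ≤ q := by
        rw [← hq]
        positivity
      have hp0 : 0 ≤ (r : ℝ) ^ m + r * dimMax d := by positivity
      generalize (r : ℝ) ^ m + r * dimMax d = p at hp0 ⊢
      have h5 : (0 : ℝ) ≤ 192 * 4 ^ m * (2 ^ m + 2 * m) := by positivity
      generalize (192 * 4 ^ m * (2 ^ m + 2 * m) : ℝ) = B at h5 ⊢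
      nlinarith [mul_nonneg h5 hq0, mul_nonneg (sq_nonneg A) hp0]
    · have h1 : D ≤ n := by
        calc D ≤ d ⟨0, hm⟩ := hd _
          _ ≤ dimMax d := le_dimMax d _
          _ ≤ m * (2 * r * dimMax d) := by
            rw [← mul_assoc]
            exact Nat.le_mul_of_pos_left _ (by positivity)
          _ ≤ n := Nat.le_add_left _ _
      have h2 : Real.log (2 / ε) ≤ n := hD.trans (by exact_mod_cast h1)
      rw [Real.log_le_iff_le_exp (by positivity), div_le_iff₀ hε] at h2
      rw [Real.exp_neg, ← div_eq_mul_inv, div_le_iff₀ (Real.exp_pos _)]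
      linarith

/-- Write `L = log (d_* / d̄) ≤ m * log d̄`. Then `r` is polylogarithmic in `d̄`, and `d_* * exp
(-L) = d̄`; rounding `r` costs only a factor `exp c`. -/
theorem lseRate_le_polylog (hm : 1 ≤ m) {s : Fin m → ℕ} (hs : ∀ k, 1 ≤ s k) {c : ℝ} (hc : 0 < c) :
    ∃ (C : ℝ) (p D : ℕ), 0 < C ∧
      ∀ d : Fin m → ℕ, (∀ k, D ≤ d k) → ∀ r : ℕ, IsFittedRank d s c r →
        lseRate d s c r ≤ C * ((dimMax d : ℝ) * Real.log (dimMax d : ℝ) ^ p) := by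
  have hsb : 1 ≤ dimMax s := (hs ⟨0, hm⟩).trans (le_dimMax s _)
  set σ := dimMax s with hσ
  set B : ℝ := (m / c) ^ σ + 1 with hB
  have hB1 : 0 ≤ B := by positivity
  -- The power `σ * m` comes from `r ^ m`; `D = 3` ensures `log d̄ ≥ 1`.
  refine ⟨B ^ m + B + Real.exp c, σ * m, 3, by positivity, fun d hd r hr => ?_⟩
  have hdb : 3 ≤ dimMax d := (hd ⟨0, hm⟩).trans (le_dimMax d _)
  have hdb' : (3 : ℝ) ≤ dimMax d := by exact_mod_cast hdb
  have hl1 : 1 ≤ Real.log (dimMax d) := by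
    rw [Real.le_log_iff_exp_le (by linarith)]
    linarith [Real.exp_one_lt_d9]
  have hle : dimMax d ≤ dimProd d := by
    refine Finset.sup_le fun k _ => ?_
    exact Finset.single_le_prod' (f := d) (fun j _ => by have := hd j; omega) (Finset.mem_univ k)
  have hprod : dimProd d ≤ dimMax d ^ m := by
    calc dimProd d ≤ ∏ _k : Fin m, dimMax d := Finset.prod_le_prod' fun k _ => le_dimMax d k
      _ = dimMax d ^ m := by simp
  have hP0 : (0 : ℝ) < dimProd d := by
    have : 0 < dimProd d := by omega
    exact_mod_cast this
  rw [IsFittedRank] at hr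
  rw [lseRate]
  set L := Real.log ((dimProd d : ℝ) / dimMax d) with hL
  set l := Real.log (dimMax d : ℝ) with hl
  have hL0 : 0 ≤ L := Real.log_nonneg (by
    rw [le_div_iff₀ (by linarith), one_mul]
    exact_mod_cast hle)
  have hLl : L ≤ m * l := by
    rw [hL, hl, ← Real.log_pow]
    refine Real.log_le_log (by positivity) ?_
    refine (div_le_self hP0.le (by linarith)).trans ?_
    exact_mod_cast hprod
  rw [← mul_pow] at hr
  obtain ⟨hr1, hr2⟩ := abs_lt.1 hr
  have hls : 1 ≤ l ^ σ := one_le_pow₀ hl1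
  have hrB : (r : ℝ) ≤ B * l ^ σ := by
    have h1 : (c⁻¹ * L) ^ σ ≤ (m / c) ^ σ * l ^ σ := by
      rw [← mul_pow]
      refine pow_le_pow_left₀ (by positivity) ?_ _
      calc c⁻¹ * L ≤ c⁻¹ * (m * l) := by gcongr
        _ = m / c * l := by ring
    rw [hB, add_mul]
    linarith
  have hlp : l ^ σ ≤ l ^ (σ * m) := pow_le_pow_right₀ hl1 (Nat.le_mul_of_pos_right _ hm)
  have hlp1 : 1 ≤ l ^ (σ * m) := one_le_pow₀ hl1
  have t1 : (r : ℝ) ^ m ≤ B ^ m * ((dimMax d : ℝ) * l ^ (σ * m)) := by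
    calc (r : ℝ) ^ m ≤ (B * l ^ σ) ^ m := by gcongr
      _ = B ^ m * (1 * l ^ (σ * m)) := by rw [mul_pow, ← pow_mul, one_mul]
      _ ≤ _ := by
        gcongr
        linarith
  have t2 : (r : ℝ) * dimMax d ≤ B * ((dimMax d : ℝ) * l ^ (σ * m)) := by
    calc (r : ℝ) * dimMax d ≤ (B * l ^ σ) * dimMax d := by gcongr
      _ ≤ (B * l ^ (σ * m)) * dimMax d := by gcongr
      _ = _ := by ring
  -- Rounding gives `(L / c) ^ σ ≤ r + 1`, and `x ^ σ + 1 ≤ (x + 1) ^ σ` moves the `1` outside the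
  -- root.
  have hroot : c⁻¹ * L ≤ (r : ℝ) ^ (1 / (σ : ℝ)) + 1 := by
    refine le_of_pow_le_pow_left₀ (n := σ) (by omega) (by positivity) ?_
    have h1 : ((r : ℝ) ^ (1 / (σ : ℝ))) ^ σ = r := by
      have : (σ : ℝ) ≠ 0 := by positivity
      rw [← Real.rpow_natCast, ← Real.rpow_mul (by positivity), one_div_mul_cancel this,
        Real.rpow_one]
    have h2 := pow_add_pow_le (x := (r : ℝ) ^ (1 / (σ : ℝ))) (y := 1) (n := σ) (by positivity)
      zero_le_one (by omega)
    rw [h1, one_pow] at h2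
    linarith
  have t3 : (dimProd d : ℝ) * Real.exp (-c * (r : ℝ) ^ (1 / (σ : ℝ))) ≤
      Real.exp c * ((dimMax d : ℝ) * l ^ (σ * m)) := by
    have h1 : -c * (r : ℝ) ^ (1 / (σ : ℝ)) ≤ c - L := by
      have := mul_le_mul_of_nonneg_left hroot hc.le
      rw [← mul_assoc, mul_inv_cancel₀ hc.ne', one_mul] at this
      linarith
    calc (dimProd d : ℝ) * Real.exp (-c * (r : ℝ) ^ (1 / (σ : ℝ)))
        ≤ dimProd d * Real.exp (c - L) := by gcongr
      _ = Real.exp c * (dimMax d * 1) := by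
        rw [Real.exp_sub, hL, Real.exp_log (by positivity)]
        field_simp
      _ ≤ _ := by gcongr
  linarith

end LatentTensor

open LatentTensor in
theorem theorem2 (m : ℕ) (hm : 1 ≤ m) (s : Fin m → ℕ) (hs : ∀ k, 1 ≤ s k) (M : ℝ) :
    -- the approximation constant `c(s, M)` and the least-squares estimator exist
    (∃ c : ℝ, IsApproxConst s M c) ∧
    (∀ (d : Fin m → ℕ) (r : ℕ) (Y : Tensor d), ∃ T : Tensor d, IsLSE r Y T) ∧
    ∀ c : ℝ, IsApproxConst s M c →
      -- the error bound, with high probability as the smallest dimension tends to infinity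
      (∃ C : ℝ, 0 < C ∧ ∀ ε : ℝ, 0 < ε → ∃ D : ℕ,
        ∀ d : Fin m → ℕ, (∀ k, D ≤ d k) → ∀ r : ℕ, IsFittedRank d s c r →
        ∀ Θ ∈ latentModel d s M,
        ∀ (Ω : Type*) [MeasurableSpace Ω] (μ : MeasureTheory.Measure Ω)
          [MeasureTheory.IsProbabilityMeasure μ] (E : Ω → Tensor d), IsGaussianNoise μ E →
        ∀ That : Ω → Tensor d, (∀ ω, IsLSE r (Θ + E ω) (That ω)) →
          μ {ω | ¬ frobNorm (That ω - Θ) ^ 2 ≤ C * lseRate d s c r} ≤ ENNReal.ofReal ε) ∧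
      -- the bound is `Õ(d̄)`
      (∃ (C : ℝ) (p D : ℕ), 0 < C ∧
        ∀ d : Fin m → ℕ, (∀ k, D ≤ d k) → ∀ r : ℕ, IsFittedRank d s c r →
          lseRate d s c r ≤ C * ((dimMax d : ℝ) * Real.log (dimMax d : ℝ) ^ p)) := by
  refine ⟨exists_isApproxConst hm hs M, exists_isLSE, fun c hc => ⟨?_, ?_⟩⟩
  · obtain ⟨C, hC, h⟩ := lse_upper_bound hm hs hc
    refine ⟨C, hC, fun ε hε => ?_⟩
    obtain ⟨D, hD⟩ := h ε hε
    exact ⟨D, fun d hd r _ => hD d hd r⟩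
  · exact lseRate_le_polylog hm hs hc.1
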